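/- Let $B,C$ be Hermitian $n\times n$ complex matrices with $C\neq 0$, let $\rho_0$ be a density matrix, and let $t_f>0$. Write $\mathcal K_X(Y)=-i[X,Y]$ and $\langle X,Y\rangle=\mathrm{Tr}(X^\dagger Y)$. A control is a measurable function $s:[0,t_f]\to[0,1]$; it drives the absolutely continuous solution $\rho$ of $$\dot\rho=\mathcal K_C\rho+s(t)\,\mathcal K_{B-C}\rho\quad\text{a.e. on }[0,t_f],\qquad \rho(0)=\rho_0 .\tag{1}$$ Assume that $s^*$ minimizes the cost $\mathrm{Tr}(C\rho(t_f))$ among all controls, and let $\rho$ be the state it drives. As usual, $s^*$ is determined only up to sets of measure zero (changing it on such a set changes neither $\rho$ nor the cost), and the pointwise statements below hold after $s^*$ has been changed on a suitable null set. (i) There is a Hermitian matrix function $p$ on $[0,t_f]$, nowhere zero, that solves $$\dot p=\mathcal K_C\,p+s^*(t)\,\mathcal K_{B-C}\,p,\qquad p(t_f)=-C,$$ such that $s^*(t)=0$ wherever $\langle p(t),\mathcal K_{B-C}\rho(t)\rangle<0$ and $s^*(t)=1$ wherever $\langle p(t),\mathcal K_{B-C}\rho(t)\rangle>0$. On every other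 interval, i.e. every nondegenerate interval $[a,b]\subseteq[0,t_f]$ that contains no nondegenerate subinterval on which $\langle p,\mathcal K_{B-C}\rho\rangle$ is everywhere negative or everywhere positive, one has $\langle p,\mathcal K_{B-C}\rho\rangle\equiv0$, so that the control Hamiltonian $\mathbb H(p,\rho,v)=\langle p,\mathcal K_C\rho\rangle+v\,\langle p,\mathcal K_{B-C}\rho\rangle$ does not depend on the control value $v$ there (a singular arc). (ii) There is a real constant $\lambda$ with $\mathbb H(p(t),\rho(t),s^*(t))=\lambda$ for all $t\in[0,t_f]$. If $\lambda>0$ (the constraint on the final time is active), then there is an $\epsilon\in(0,t_f]$ with $s^*(t)=1$ for all $t\in(t_f-\epsilon,t_f]$. If $\lambda>0$ and moreover $[B,\rho_0]=0$, then there is also an $\epsilon'\in(0,t_f]$ with $s^*(t)=0$ for all $t\in[0,\epsilon')$. -/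

import Mathlib

open scoped Matrix ComplexOrder

namespace QControl

/-- The superoperator `𝒦_X Y = -i [X, Y]`. -/
def K {n : ℕ} (X Y : Matrix (Fin n) (Fin n) ℂ) : Matrix (Fin n) (Fin n) ℂ :=
  (-Complex.I) • (X * Y - Y * X)

/-- The Hilbert–Schmidt product `⟨X, Y⟩ = Tr (X† Y)`. -/
def hs {n : ℕ} (X Y : Matrix (Fin n) (Fin n) ℂ) : ℂ := (Xᴴ * Y).trace

/-- A density matrix: positive semidefinite of trace one. -/
def IsDensity {n : ℕ} (ρ : Matrix (Fin n) (Fin n) ℂ) : Prop :=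
  ρ.PosSemidef ∧ ρ.trace = 1

/-- The controlled Liouvillian `𝓛 = 𝒦_C + v 𝒦_{B-C}`. -/
def liouv {n : ℕ} (B C : Matrix (Fin n) (Fin n) ℂ) (v : ℝ) (X : Matrix (Fin n) (Fin n) ℂ) :
    Matrix (Fin n) (Fin n) ℂ :=
  K C X + (v : ℂ) • K (B - C) X

/-- An admissible control on `[0, T]`: a Lebesgue measurable function with values in `[0, 1]`. -/
def IsControl (T : ℝ) (s : ℝ → ℝ) : Prop :=
  AEMeasurable s (MeasureTheory.volume.restrict (Set.Icc 0 T)) ∧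
    ∀ t ∈ Set.Icc 0 T, s t ∈ Set.Icc (0 : ℝ) 1

/-- `X` is a (Carathéodory) solution on `[0, T]` of `Ẋ = 𝒦_C X + s(t) 𝒦_{B-C} X`: it is continuous
and satisfies the integrated equation, written entry by entry. -/
def IsSolution {n : ℕ} (B C : Matrix (Fin n) (Fin n) ℂ) (T : ℝ) (s : ℝ → ℝ)
    (X : ℝ → Matrix (Fin n) (Fin n) ℂ) : Prop :=
  ContinuousOn X (Set.Icc 0 T) ∧
    ∀ t ∈ Set.Icc 0 T, ∀ i j, X t i j = X 0 i j + ∫ τ in (0 : ℝ)..t, liouv B C (s τ) (X τ) i j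

/-- The cost `Tr (C ρ)` of a final state `ρ` (a real number, see `trace_mul_im`). -/
def cost {n : ℕ} (C ρ : Matrix (Fin n) (Fin n) ℂ) : ℝ := (C * ρ).trace.re

/-- `(ρ, s)` is an optimal pair: `s` is an admissible control, `ρ` is the state driven by `s` from
`ρ₀`, and no admissible control reaches a lower cost at the fixed final time `T`. -/
def IsOptimalPair {n : ℕ} (B C ρ₀ : Matrix (Fin n) (Fin n) ℂ) (T : ℝ)
    (ρ : ℝ → Matrix (Fin n) (Fin n) ℂ) (s : ℝ → ℝ) : Prop :=
  (IsControl T s ∧ IsSolution B C T s ρ ∧ ρ 0 = ρ₀) ∧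
    ∀ (s' : ℝ → ℝ) (ρ' : ℝ → Matrix (Fin n) (Fin n) ℂ),
      IsControl T s' → IsSolution B C T s' ρ' → ρ' 0 = ρ₀ → cost C (ρ T) ≤ cost C (ρ' T)

/-- The control Hamiltonian `ℍ(p, ρ, v) = ⟨p, 𝓛 ρ⟩` with control value `v` (a real number for
Hermitian `p` and `ρ`, see `hs_K_im`). -/
def pmpH {n : ℕ} (B C p ρ : Matrix (Fin n) (Fin n) ℂ) (v : ℝ) : ℝ :=
  (hs p (liouv B C v ρ)).re

/-- The switching function `⟨p, 𝒦_{B-C} ρ⟩` (a real number for Hermitian `p` and `ρ`, see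
`hs_K_im`). -/
def switching {n : ℕ} (B C p ρ : Matrix (Fin n) (Fin n) ℂ) : ℝ :=
  (hs p (K (B - C) ρ)).re

theorem trace_mul_im {n : ℕ} {A B : Matrix (Fin n) (Fin n) ℂ} (hA : A.IsHermitian)
    (hB : B.IsHermitian) : (A * B).trace.im = 0 := by
  have h : star (A * B).trace = (A * B).trace := by
    rw [← Matrix.trace_conjTranspose, Matrix.conjTranspose_mul, hA.eq, hB.eq, Matrix.trace_mul_comm]
  exact Complex.conj_eq_iff_im.mp h

theorem K_isHermitian {n : ℕ} {X Y : Matrix (Fin n) (Fin n) ℂ} (hX : X.IsHermitian)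
    (hY : Y.IsHermitian) : (K X Y).IsHermitian := by
  unfold K Matrix.IsHermitian
  rw [Matrix.conjTranspose_smul, Matrix.conjTranspose_sub, Matrix.conjTranspose_mul,
    Matrix.conjTranspose_mul, hX.eq, hY.eq, ← neg_sub (X * Y), smul_neg, ← neg_smul]
  simp

theorem hs_K_im {n : ℕ} {p X ρ : Matrix (Fin n) (Fin n) ℂ} (hp : p.IsHermitian)
    (hX : X.IsHermitian) (hρ : ρ.IsHermitian) : (hs p (K X ρ)).im = 0 := by
  unfold hs
  rw [hp.eq]
  exact trace_mul_im hp (K_isHermitian hX hρ)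

end QControl

open QControl

/-!
The superoperators `𝒦_X` of Hermitian `X` are skew-adjoint for the Hilbert–Schmidt product. Hence, for
a co-state `p` driven by a control `s₁` and a state `R` driven by `s₂`,
`Re ⟨p, R⟩ (t) - Re ⟨p, R⟩ (0) = ∫₀ᵗ (s₂ - s₁) Re ⟨p, 𝒦_{B-C} R⟩` (`IsSolution.re_hs_sub`). This identity
carries the whole proof.

With `p(T) = -C` and a perturbed control `s + ε (v - s)` driving `R`, it turns optimality into
`∫ (v - s) ⟨p, 𝒦_{B-C} R⟩ ≤ 0`. Applied to the pairs `(ρ, R)`, `(ρ, ρ)` and `(R, R)` it gives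
`‖R - ρ‖² = O(ε)`. In the limit `∫ (v - s) Φ ≤ 0` with the switching function `Φ = ⟨p, 𝒦_{B-C} ρ⟩`
(`IsOptimalPair.integral_le_zero`), and the choice `v = 1` on `{Φ > 0}`, `v = 0` elsewhere shows that
`s = v` almost everywhere on `{Φ ≠ 0}` (`IsOptimalPair.ae_maximizes`).

The switching function has the continuous derivative `D = ⟨p, [𝒦_{B-C}, 𝒦_C] ρ⟩`, whereas `⟨p, 𝒦_C ρ⟩` has
the derivative `-s D` almost everywhere. Therefore `⟨p, 𝒦_C ρ⟩ + max Φ 0` is absolutely continuous with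
derivative zero almost everywhere, so it is constant (`maximizedHamiltonian_const`). Redefining `s` on
the null set where it violates the sign conditions makes this constant the value of the control
Hamiltonian at every time. The claims about the first and the last arc are read off from this value
at `0` and `T` and from the continuity of `Φ`.

Solutions for measurable controls are obtained from a contraction in a weighted supremum norm
(`exists_linear_caratheodory_solution`), and the co-state from them by reversing time.
-/

open MeasureTheory Set

/-! ### Absolutely continuous and continuous functions on an interval -/

theorem AbsolutelyContinuousOnInterval.comp_lipschitz {X Y : Type*} [PseudoMetricSpace X]
    [PseudoMetricSpace Y] {f : ℝ → X} {a b : ℝ} (hf : AbsolutelyContinuousOnInterval f a b)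
    {φ : X → Y} (hφ : LipschitzWith 1 φ) :
    AbsolutelyContinuousOnInterval (fun t => φ (f t)) a b := by
  rw [absolutelyContinuousOnInterval_iff] at hf ⊢
  intro ε hε
  obtain ⟨δ, hδ, h⟩ := hf ε hε
  refine ⟨δ, hδ, fun E hE hlt => (Finset.sum_le_sum fun i _ => ?_).trans_lt (h E hE hlt)⟩
  simpa using hφ.dist_le_mul (f (E.2 i).1) (f (E.2 i).2)

theorem absolutelyContinuousOnInterval_const {X : Type*} [PseudoMetricSpace X] (c : X) (a b : ℝ) :
    AbsolutelyContinuousOnInterval (fun _ => c) a b :=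
  (LipschitzWith.const c).lipschitzOnWith.absolutelyContinuousOnInterval

theorem AbsolutelyContinuousOnInterval.finset_sum {F ι : Type*} [SeminormedAddCommGroup F]
    {f : ι → ℝ → F} {a b : ℝ} (I : Finset ι)
    (hf : ∀ i ∈ I, AbsolutelyContinuousOnInterval (f i) a b) :
    AbsolutelyContinuousOnInterval (fun t => ∑ i ∈ I, f i t) a b := by
  classical
  induction I using Finset.induction_on with
  | empty => simpa using absolutelyContinuousOnInterval_const (0 : F) a b
  | insert i I hi ih =>
    simp only [Finset.sum_insert hi]
    exact (hf i (Finset.mem_insert_self i I)).fun_add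
      (ih fun j hj => hf j (Finset.mem_insert_of_mem hj))

/-- The product, stated pointwise; `AbsolutelyContinuousOnInterval.mul` is restricted to real
functions. -/
theorem AbsolutelyContinuousOnInterval.mul_complex {f g : ℝ → ℂ} {a b : ℝ}
    (hf : AbsolutelyContinuousOnInterval f a b) (hg : AbsolutelyContinuousOnInterval g a b) :
    AbsolutelyContinuousOnInterval (fun t => f t * g t) a b :=
  hf.smul hg

/-- The fundamental theorem of calculus, for a prescribed representative of the derivative. -/
theorem AbsolutelyContinuousOnInterval.integral_eq_sub_of_ae_hasDerivAt {f g : ℝ → ℝ} {T : ℝ}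
    (hf : AbsolutelyContinuousOnInterval f 0 T)
    (hg : ∀ᵐ t, t ∈ Ioo 0 T → HasDerivAt f (g t) t) {t : ℝ} (ht : t ∈ Icc 0 T) :
    ∫ τ in (0 : ℝ)..t, g τ = f t - f 0 := by
  rw [← (hf.mono (c := 0) (d := t) ?_).integral_deriv_eq_sub]
  · apply intervalIntegral.integral_congr_ae
    have hne : ∀ᵐ x : ℝ, x ≠ T := by simp [ae_iff]
    filter_upwards [hg, hne] with x hx hxT hx'
    rw [uIoc_of_le ht.1] at hx'
    exact (hx ⟨hx'.1, lt_of_le_of_ne (hx'.2.trans ht.2) hxT⟩).deriv.symm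
  · rw [uIcc_of_le ht.1, uIcc_of_le (ht.1.trans ht.2)]
    exact Icc_subset_Icc_right ht.2

theorem AbsolutelyContinuousOnInterval.max_zero {f : ℝ → ℝ} {a b : ℝ}
    (hf : AbsolutelyContinuousOnInterval f a b) :
    AbsolutelyContinuousOnInterval (fun t => max (f t) 0) a b :=
  hf.comp_lipschitz (φ := fun x => max x 0) (LipschitzWith.id.max_const 0)

/-- A continuous function without a nondegenerate subinterval of strict sign vanishes. -/
theorem eq_zero_of_no_sign_interval {f : ℝ → ℝ} {a b : ℝ} (hab : a < b)
    (hf : ContinuousOn f (Icc a b))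
    (h : ¬ ∃ c d : ℝ, a ≤ c ∧ c < d ∧ d ≤ b ∧
      ((∀ t ∈ Ioo c d, f t < 0) ∨ ∀ t ∈ Ioo c d, 0 < f t)) :
    ∀ t ∈ Icc a b, f t = 0 := by
  have key : ∀ g : ℝ → ℝ, ContinuousOn g (Icc a b) → ∀ t ∈ Icc a b, 0 < g t →
      ∃ c d : ℝ, a ≤ c ∧ c < d ∧ d ≤ b ∧ ∀ t ∈ Ioo c d, 0 < g t := by
    intro g hg t ht hpos
    obtain ⟨δ, hδ, hball⟩ := Metric.mem_nhdsWithin_iff.1 ((hg t ht).eventually_const_lt hpos)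
    refine ⟨max a (t - δ), min b (t + δ), le_max_left _ _, ?_, min_le_left _ _, fun u hu => ?_⟩
    · simp only [max_lt_iff, lt_min_iff]
      refine ⟨⟨hab, ?_⟩, ?_, ?_⟩ <;> linarith [ht.1, ht.2]
    · simp only [mem_Ioo, max_lt_iff, lt_min_iff] at hu
      refine hball ⟨?_, hu.1.1.le, hu.2.1.le⟩
      rw [Metric.mem_ball, Real.dist_eq, abs_lt]
      constructor <;> linarith [hu.1.2, hu.2.2]
  intro t ht
  rcases lt_trichotomy (f t) 0 with hneg | h0 | hpos
  · obtain ⟨c, d, h1, h2, h3, h4⟩ := key (fun t => -f t) hf.neg t ht (by simpa using hneg)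
    exact absurd ⟨c, d, h1, h2, h3, Or.inl fun u hu => by simpa using h4 u hu⟩ h
  · exact h0
  · obtain ⟨c, d, h1, h2, h3, h4⟩ := key f hf t ht hpos
    exact absurd ⟨c, d, h1, h2, h3, Or.inr h4⟩ h

theorem exists_Ioc_pos_of_continuousOn {Φ : ℝ → ℝ} {T : ℝ} (hT : 0 < T) (hΦ : ContinuousOn Φ (Icc 0 T))
    (h : 0 < Φ T) : ∃ ε : ℝ, 0 < ε ∧ ε ≤ T ∧ ∀ t ∈ Ioc (T - ε) T, 0 < Φ t := by
  obtain ⟨δ, hδ, hball⟩ := Metric.mem_nhdsWithin_iff.1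
    ((hΦ T ⟨hT.le, le_rfl⟩).eventually_const_lt h)
  refine ⟨min δ T, lt_min hδ hT, min_le_right _ _, fun t ht => ?_⟩
  have hm : t ∈ Icc 0 T := ⟨by linarith [ht.1, min_le_right δ T], ht.2⟩
  refine hball ⟨?_, hm⟩
  rw [Metric.mem_ball, Real.dist_eq, abs_lt]
  constructor <;> linarith [ht.1, ht.2, min_le_left δ T]

theorem exists_Ico_neg_of_continuousOn {Φ : ℝ → ℝ} {T : ℝ} (hT : 0 < T) (hΦ : ContinuousOn Φ (Icc 0 T))
    (h : Φ 0 < 0) : ∃ ε : ℝ, 0 < ε ∧ ε ≤ T ∧ ∀ t ∈ Ico 0 ε, Φ t < 0 := by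
  obtain ⟨δ, hδ, hball⟩ := Metric.mem_nhdsWithin_iff.1
    ((hΦ 0 ⟨le_rfl, hT.le⟩).eventually_lt_const h)
  refine ⟨min δ T, lt_min hδ hT, min_le_right _ _, fun t ht => ?_⟩
  have hm : t ∈ Icc 0 T := ⟨ht.1, by linarith [ht.2, min_le_right δ T]⟩
  refine hball ⟨?_, hm⟩
  rw [Metric.mem_ball, Real.dist_eq, abs_lt]
  constructor <;> linarith [ht.1, ht.2, min_le_left δ T]

/-! ### Linear differential equations with measurable coefficients -/

/-- Linear Carathéodory existence: a linear equation with bounded measurable coefficients has a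
solution with any initial value. The Picard map is a contraction of `C([0, T], E)` for the norm
weighted by `exp (-k t)` with `k` larger than twice the bound of the coefficients; the weight is
carried by the unknown, `X t = exp (k t) • Y t`. -/
theorem exists_linear_caratheodory_solution {E : Type*} [NormedAddCommGroup E] [NormedSpace ℝ E]
    [CompleteSpace E] {T M : ℝ} (hT : 0 ≤ T) {L : ℝ → E →L[ℝ] E}
    (hL : AEStronglyMeasurable L (volume.restrict (Icc 0 T))) (hM : ∀ t ∈ Icc 0 T, ‖L t‖ ≤ M)
    (x₀ : E) :
    ∃ X : ℝ → E, Continuous X ∧ IntegrableOn (fun τ => L τ (X τ)) (Icc 0 T) ∧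
      ∀ t ∈ Icc 0 T, X t = x₀ + ∫ τ in (0 : ℝ)..t, L τ (X τ) := by
  have hM0 : 0 ≤ M := (norm_nonneg _).trans (hM 0 ⟨le_rfl, hT⟩)
  set k : ℝ := 2 * M + 1 with hk
  have hk0 : 0 < k := by positivity
  have hint : ∀ Z : ℝ → E, Continuous Z → IntegrableOn (fun τ => L τ (Z τ)) (Icc 0 T) := by
    intro Z hZ
    obtain ⟨c, hc⟩ := isCompact_Icc.exists_bound_of_continuousOn (s := Icc (0 : ℝ) T)
      hZ.continuousOn
    refine IntegrableOn.of_bound (C := M * c) (by simp)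
      ((ContinuousLinearMap.id ℝ (E →L[ℝ] E)).aestronglyMeasurable_comp₂ hL
        hZ.aestronglyMeasurable) ((ae_restrict_iff' measurableSet_Icc).2 (.of_forall ?_))
    intro t ht
    exact (ContinuousLinearMap.le_opNorm _ _).trans
      (mul_le_mul (hM t ht) (hc t ht) (norm_nonneg _) hM0)
  -- the weighted curve `τ ↦ exp (k τ) • Y τ`, with `Y` extended constantly beyond `[0, T]`
  let W : C(Icc (0 : ℝ) T, E) → ℝ → E := fun Y τ => Real.exp (k * τ) • Y (projIcc 0 T hT τ)
  have hW : ∀ Y, Continuous (W Y) := fun Y =>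
    (by fun_prop : Continuous fun τ : ℝ => Real.exp (k * τ)).smul
      (Y.continuous.comp continuous_projIcc)
  have hprim : ∀ Y, ContinuousOn (fun t => ∫ τ in (0 : ℝ)..t, L τ (W Y τ)) (Icc 0 T) := by
    intro Y
    have := intervalIntegral.continuousOn_primitive_interval (μ := volume) (a := (0 : ℝ)) (b := T)
      (f := fun τ => L τ (W Y τ)) (by rw [uIcc_of_le hT]; exact hint _ (hW Y))
    rwa [uIcc_of_le hT] at this
  let F : C(Icc (0 : ℝ) T, E) → C(Icc (0 : ℝ) T, E) := fun Y =>
    ⟨fun t => Real.exp (-(k * t)) • (x₀ + ∫ τ in (0 : ℝ)..t, L τ (W Y τ)), by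
      have := continuousOn_iff_continuous_domRestrict.1 (hprim Y)
      exact (by fun_prop : Continuous fun t : Icc (0 : ℝ) T => Real.exp (-(k * t))).smul
        (continuous_const.add this)⟩
  have hii : ∀ Y, ∀ t ∈ Icc 0 T, IntervalIntegrable (fun τ => L τ (W Y τ)) volume 0 t := by
    intro Y t ht
    rw [intervalIntegrable_iff_integrableOn_Icc_of_le ht.1]
    exact (hint _ (hW Y)).mono_set (Icc_subset_Icc_right ht.2)
  have hF : ContractingWith (1 / 2) F := by
    refine ⟨by rw [← NNReal.coe_lt_coe]; norm_num, LipschitzWith.of_dist_le_mul fun Y Z => ?_⟩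
    rw [ContinuousMap.dist_le (by positivity)]
    rintro ⟨t, ht⟩
    have h1 : ‖∫ τ in (0 : ℝ)..t, (L τ (W Y τ) - L τ (W Z τ))‖ ≤
        ∫ τ in (0 : ℝ)..t, M * dist Y Z * Real.exp (k * τ) := by
      refine intervalIntegral.norm_integral_le_of_norm_le ht.1 (.of_forall fun τ hτ => ?_)
        (Continuous.intervalIntegrable (by fun_prop) _ _)
      have hτ' : τ ∈ Icc 0 T := ⟨hτ.1.le, hτ.2.trans ht.2⟩
      rw [← map_sub, ← smul_sub]
      refine (ContinuousLinearMap.le_opNorm _ _).trans ?_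
      rw [norm_smul, Real.norm_of_nonneg (Real.exp_pos _).le, ← dist_eq_norm, mul_assoc,
        mul_comm (dist Y Z)]
      exact mul_le_mul (hM τ hτ')
        (mul_le_mul_of_nonneg_left (ContinuousMap.dist_apply_le_dist _) (Real.exp_pos _).le)
        (by positivity) hM0
    have h2 : ∫ τ in (0 : ℝ)..t, Real.exp (k * τ) ≤ Real.exp (k * t) / k := by
      rw [intervalIntegral.integral_comp_mul_left (fun x => Real.exp x) hk0.ne', integral_exp,
        smul_eq_mul, ← div_eq_inv_mul]
      gcongr
      simp
    change dist (Real.exp (-(k * t)) • (x₀ + ∫ τ in (0 : ℝ)..t, L τ (W Y τ)))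
      (Real.exp (-(k * t)) • (x₀ + ∫ τ in (0 : ℝ)..t, L τ (W Z τ))) ≤ _
    rw [dist_eq_norm, ← smul_sub, add_sub_add_left_eq_sub,
      ← intervalIntegral.integral_sub (hii Y t ht) (hii Z t ht), norm_smul,
      Real.norm_of_nonneg (Real.exp_pos _).le]
    rw [intervalIntegral.integral_const_mul] at h1
    calc Real.exp (-(k * t)) * ‖∫ τ in (0 : ℝ)..t, (L τ (W Y τ) - L τ (W Z τ))‖
        ≤ Real.exp (-(k * t)) * (M * dist Y Z * (Real.exp (k * t) / k)) := by
          gcongr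
          exact h1.trans (by gcongr)
      _ = (M / k) * dist Y Z := by
          rw [Real.exp_neg]; field_simp
      _ ≤ _ := by
          gcongr
          rw [div_le_iff₀ hk0, hk]
          push_cast; linarith
  obtain ⟨Y, hY, -⟩ := hF.exists_fixedPoint (0 : C(Icc (0 : ℝ) T, E)) (edist_ne_top _ _)
  refine ⟨W Y, hW Y, hint _ (hW Y), fun t ht => ?_⟩
  have : Y ⟨t, ht⟩ = Real.exp (-(k * t)) • (x₀ + ∫ τ in (0 : ℝ)..t, L τ (W Y τ)) := by
    conv_lhs => rw [← hY.eq]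
    rfl
  change Real.exp (k * t) • Y (projIcc 0 T hT t) = _
  rw [projIcc_of_mem hT ht, this, smul_smul, ← Real.exp_add]
  simp

namespace QControl

variable {n : ℕ}

/-! ### The superoperators and the Hilbert–Schmidt product -/

theorem K_add (X Y Z : Matrix (Fin n) (Fin n) ℂ) : K X (Y + Z) = K X Y + K X Z := by
  simp only [K, mul_add, add_mul, ← smul_add]; congr 1; abel

theorem K_smul (X : Matrix (Fin n) (Fin n) ℂ) (c : ℂ) (Y : Matrix (Fin n) (Fin n) ℂ) :
    K X (c • Y) = c • K X Y := by
  simp only [K, mul_smul_comm, smul_mul_assoc, ← smul_sub]; rw [smul_comm]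

/-- `Y ↦ 𝒦_X Y` as a linear map. -/
def KLin (X : Matrix (Fin n) (Fin n) ℂ) :
    Matrix (Fin n) (Fin n) ℂ →ₗ[ℂ] Matrix (Fin n) (Fin n) ℂ where
  toFun := K X
  map_add' := K_add X
  map_smul' := K_smul X

theorem K_conjTranspose {X : Matrix (Fin n) (Fin n) ℂ} (hX : X.IsHermitian)
    (Y : Matrix (Fin n) (Fin n) ℂ) : (K X Y)ᴴ = K X Yᴴ := by
  unfold K
  rw [Matrix.conjTranspose_smul, Matrix.conjTranspose_sub, Matrix.conjTranspose_mul,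
    Matrix.conjTranspose_mul, hX.eq, ← neg_sub (X * Yᴴ), smul_neg, ← neg_smul]
  simp

theorem hs_eq_sum (X Y : Matrix (Fin n) (Fin n) ℂ) :
    hs X Y = ∑ i, ∑ j, star (X j i) * Y j i := by
  simp [hs, Matrix.trace, Matrix.mul_apply]

theorem hs_add_right (X Y Z : Matrix (Fin n) (Fin n) ℂ) : hs X (Y + Z) = hs X Y + hs X Z := by
  simp [hs, mul_add]

theorem hs_sub_right (X Y Z : Matrix (Fin n) (Fin n) ℂ) : hs X (Y - Z) = hs X Y - hs X Z := by
  simp [hs, mul_sub]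

theorem hs_smul_right (c : ℂ) (X Y : Matrix (Fin n) (Fin n) ℂ) : hs X (c • Y) = c * hs X Y := by
  simp [hs]

theorem hs_add_left (X Y Z : Matrix (Fin n) (Fin n) ℂ) : hs (X + Y) Z = hs X Z + hs Y Z := by
  simp [hs, add_mul]

theorem hs_sub_left (X Y Z : Matrix (Fin n) (Fin n) ℂ) : hs (X - Y) Z = hs X Z - hs Y Z := by
  simp [hs, sub_mul]

theorem hs_neg_left (X Y : Matrix (Fin n) (Fin n) ℂ) : hs (-X) Y = -hs X Y := by
  simp [hs]

theorem hs_ofReal_smul_left (r : ℝ) (X Y : Matrix (Fin n) (Fin n) ℂ) :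
    hs ((r : ℂ) • X) Y = r * hs X Y := by
  simp [hs, Matrix.conjTranspose_smul]

theorem hs_re_comm (X Y : Matrix (Fin n) (Fin n) ℂ) : (hs X Y).re = (hs Y X).re := by
  have : hs Y X = star (hs X Y) := by
    rw [hs, hs, ← Matrix.trace_conjTranspose, Matrix.conjTranspose_mul,
      Matrix.conjTranspose_conjTranspose]
  rw [this]; simp

/-- For Hermitian `X` the superoperator `𝒦_X` is skew-adjoint. -/
theorem hs_K_left {X : Matrix (Fin n) (Fin n) ℂ} (hX : X.IsHermitian)
    (P R : Matrix (Fin n) (Fin n) ℂ) : hs (K X P) R = -hs P (K X R) := by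
  rw [hs, K_conjTranspose hX, hs, K, K]
  simp only [smul_mul_assoc, mul_smul_comm, Matrix.trace_smul, sub_mul, mul_sub, Matrix.trace_sub]
  rw [Matrix.mul_assoc X, Matrix.trace_mul_comm X, Matrix.mul_assoc Pᴴ, Matrix.mul_assoc Pᴴ]
  simp only [smul_eq_mul]; ring

theorem hs_liouv_left {B C : Matrix (Fin n) (Fin n) ℂ} (hB : B.IsHermitian) (hC : C.IsHermitian)
    (v : ℝ) (P R : Matrix (Fin n) (Fin n) ℂ) :
    hs (liouv B C v P) R = -hs P (liouv B C v R) := by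
  rw [liouv, liouv, hs_add_left, hs_add_right, hs_ofReal_smul_left, hs_smul_right, hs_K_left hC,
    hs_K_left (hB.sub hC)]
  ring

theorem hs_K_self {X : Matrix (Fin n) (Fin n) ℂ} (hX : X.IsHermitian)
    (R : Matrix (Fin n) (Fin n) ℂ) : hs X (K X R) = 0 := by
  rw [← neg_eq_zero, ← hs_K_left hX]
  simp [K, hs]

theorem K_sub_eq_neg {B C R : Matrix (Fin n) (Fin n) ℂ} (h : K B R = 0) :
    K (B - C) R = -K C R := by
  have : K (B - C) R = K B R - K C R := by
    simp only [K, sub_mul, mul_sub, ← smul_sub]; congr 1; abel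
  rw [this, h, zero_sub]

theorem re_star_mul_self_nonneg (z : ℂ) : 0 ≤ (star z * z).re := by
  simp only [Complex.star_def, Complex.mul_re, Complex.conj_re, Complex.conj_im]
  nlinarith [mul_self_nonneg z.re, mul_self_nonneg z.im]

theorem hs_self_re_nonneg (X : Matrix (Fin n) (Fin n) ℂ) : 0 ≤ (hs X X).re := by
  simp only [hs_eq_sum, Complex.re_sum]
  exact Finset.sum_nonneg fun i _ => Finset.sum_nonneg fun j _ => re_star_mul_self_nonneg _

theorem eq_zero_of_hs_self_re {X : Matrix (Fin n) (Fin n) ℂ} (h : (hs X X).re = 0) : X = 0 := by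
  simp only [hs_eq_sum, Complex.re_sum] at h
  rw [Finset.sum_eq_zero_iff_of_nonneg fun i _ => Finset.sum_nonneg fun j _ =>
    re_star_mul_self_nonneg _] at h
  ext j i
  have h1 := h i (Finset.mem_univ i)
  rw [Finset.sum_eq_zero_iff_of_nonneg fun j _ => re_star_mul_self_nonneg _] at h1
  have h2 := h1 j (Finset.mem_univ j)
  simp only [Complex.star_def, Complex.mul_re, Complex.conj_re, Complex.conj_im] at h2
  exact Complex.normSq_eq_zero.1 (by rw [Complex.normSq_apply]; linarith)

/-- The Cauchy–Schwarz inequality in its weighted arithmetic–geometric form. -/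
theorem abs_re_hs_le {η : ℝ} (hη : 0 < η) (A X : Matrix (Fin n) (Fin n) ℂ) :
    |(hs A X).re| ≤ (η * (hs A A).re + (hs X X).re / η) / 2 := by
  -- expand `0 ≤ ⟨η σ A - X, η σ A - X⟩` for the two signs `σ`
  have key : ∀ σ : ℝ, σ ^ 2 = 1 → σ * (hs A X).re ≤ (η * (hs A A).re + (hs X X).re / η) / 2 := by
    intro σ hσ
    have h := hs_self_re_nonneg (((η * σ : ℝ) : ℂ) • A - X)
    rw [hs_sub_left, hs_sub_right, hs_sub_right, hs_ofReal_smul_left, hs_ofReal_smul_left,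
      hs_smul_right, hs_smul_right] at h
    simp only [Complex.sub_re, Complex.re_ofReal_mul] at h
    rw [hs_re_comm X A] at h
    have e : (η * (hs A A).re + (hs X X).re / η) / 2 - σ * (hs A X).re =
        (η * σ * (η * σ * (hs A A).re) - η * σ * (hs A X).re -
          (η * σ * (hs A X).re - (hs X X).re)) / (2 * η) := by
      rw [show η * σ * (η * σ * (hs A A).re) = η ^ 2 * σ ^ 2 * (hs A A).re by ring, hσ]
      field_simp
      ring
    have : 0 ≤ (η * (hs A A).re + (hs X X).re / η) / 2 - σ * (hs A X).re := by
      rw [e]; exact div_nonneg h (by positivity)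
    linarith
  rw [abs_le']
  exact ⟨by simpa using key 1 (by norm_num), by simpa using key (-1) (by norm_num)⟩

/-! ### Curves of matrices and solutions of the controlled equation -/

/-- `X` is a matrix curve on `[0, T]` with absolutely continuous entries whose derivative is
almost everywhere `X'`. -/
structure IsACCurve (T : ℝ) (X X' : ℝ → Matrix (Fin n) (Fin n) ℂ) : Prop where
  absCont : ∀ i j, AbsolutelyContinuousOnInterval (fun t => X t i j) 0 T
  hasDerivAt : ∀ᵐ t, t ∈ Ioo 0 T → ∀ i j, HasDerivAt (fun τ => X τ i j) (X' t i j) t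

theorem IsACCurve.K_comp {T : ℝ} {X X' : ℝ → Matrix (Fin n) (Fin n) ℂ} (h : IsACCurve T X X')
    (D : Matrix (Fin n) (Fin n) ℂ) : IsACCurve T (fun t => K D (X t)) (fun t => K D (X' t)) := by
  have e : ∀ (Y : Matrix (Fin n) (Fin n) ℂ) i j, K D Y i j =
      -Complex.I * (∑ k, D i k * Y k j - ∑ k, D k j * Y i k) := by
    intro Y i j
    simp [K, Matrix.mul_apply, mul_comm (Y i _)]
  constructor
  · intro i j
    simp only [e]
    refine .mul_complex (absolutelyContinuousOnInterval_const _ _ _) (.fun_sub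
      (.finset_sum _ fun k _ => .mul_complex (absolutelyContinuousOnInterval_const _ _ _) ?_)
      (.finset_sum _ fun k _ => .mul_complex (absolutelyContinuousOnInterval_const _ _ _) ?_))
    · exact h.absCont k j
    · exact h.absCont i k
  · filter_upwards [h.hasDerivAt] with t ht hT i j
    simp only [e]
    exact ((HasDerivAt.fun_sum fun k _ => (ht hT k j).const_mul _).sub
      (HasDerivAt.fun_sum fun k _ => (ht hT i k).const_mul _)).const_mul _

theorem IsACCurve.absCont_re_hs {T : ℝ} {P P' R R' : ℝ → Matrix (Fin n) (Fin n) ℂ}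
    (hP : IsACCurve T P P') (hR : IsACCurve T R R') :
    AbsolutelyContinuousOnInterval (fun t => (hs (P t) (R t)).re) 0 T := by
  refine AbsolutelyContinuousOnInterval.comp_lipschitz (φ := Complex.re) ?_ ?_
  · simp only [hs_eq_sum]
    refine .finset_sum _ fun i _ => .finset_sum _ fun j _ => ?_
    refine .mul_complex ?_ (hR.absCont j i)
    exact (hP.absCont j i).comp_lipschitz (φ := star)
      (LipschitzWith.of_dist_le_mul fun x y => by
        rw [NNReal.coe_one, one_mul, dist_eq_norm, ← star_sub, norm_star, dist_eq_norm])
  · refine LipschitzWith.of_dist_le_mul fun x y => ?_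
    simpa [dist_eq_norm] using Complex.abs_re_le_norm (x - y)

theorem IsACCurve.hasDerivAt_re_hs {T : ℝ} {P P' R R' : ℝ → Matrix (Fin n) (Fin n) ℂ}
    (hP : IsACCurve T P P') (hR : IsACCurve T R R') :
    ∀ᵐ t, t ∈ Ioo 0 T → HasDerivAt (fun τ => (hs (P τ) (R τ)).re)
      ((hs (P' t) (R t)).re + (hs (P t) (R' t)).re) t := by
  filter_upwards [hP.hasDerivAt, hR.hasDerivAt] with t h1 h2 hT
  have : HasDerivAt (fun τ => hs (P τ) (R τ)) (hs (P' t) (R t) + hs (P t) (R' t)) t := by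
    simp only [hs_eq_sum, ← Finset.sum_add_distrib]
    exact HasDerivAt.fun_sum fun i _ => HasDerivAt.fun_sum fun j _ =>
      ((h1 hT j i).star).mul (h2 hT j i)
  rw [← Complex.add_re]
  exact Complex.reCLM.hasFDerivAt.comp_hasDerivAt t this

theorem continuous_K (D : Matrix (Fin n) (Fin n) ℂ) : Continuous (K D) := by
  unfold K; fun_prop

theorem continuousOn_hs {P R : ℝ → Matrix (Fin n) (Fin n) ℂ} {S : Set ℝ} (hP : ContinuousOn P S)
    (hR : ContinuousOn R S) : ContinuousOn (fun t => hs (P t) (R t)) S := by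
  have hent : ∀ {Y : ℝ → Matrix (Fin n) (Fin n) ℂ}, ContinuousOn Y S → ∀ i j,
      ContinuousOn (fun t => Y t i j) S := fun hY i j =>
    (continuous_id.matrix_elem i j).comp_continuousOn hY
  simp only [hs_eq_sum]
  exact continuousOn_finsetSum _ fun i _ => continuousOn_finsetSum _ fun j _ =>
    (continuous_star.comp_continuousOn (hent hP j i)).mul (hent hR j i)

theorem continuousOn_K {R : ℝ → Matrix (Fin n) (Fin n) ℂ} {S : Set ℝ}
    (D : Matrix (Fin n) (Fin n) ℂ) (hR : ContinuousOn R S) :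
    ContinuousOn (fun t => K D (R t)) S :=
  (continuous_K D).comp_continuousOn hR

/-- The right-hand side of the equation is bounded and integrable along a continuous curve. -/
theorem liouv_entry_integrableOn {B C : Matrix (Fin n) (Fin n) ℂ} {T : ℝ} {s : ℝ → ℝ}
    {X : ℝ → Matrix (Fin n) (Fin n) ℂ} (hs : IsControl T s) (hX : ContinuousOn X (Icc 0 T))
    (i j : Fin n) :
    (∃ M, ∀ t ∈ Icc 0 T, ‖liouv B C (s t) (X t) i j‖ ≤ M) ∧
      IntegrableOn (fun t => liouv B C (s t) (X t) i j) (Icc 0 T) := by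
  have hc : ∀ D : Matrix (Fin n) (Fin n) ℂ, ContinuousOn (fun t => K D (X t) i j) (Icc 0 T) := by
    intro D
    have := (continuous_K D).comp_continuousOn hX
    exact ((continuous_apply j).comp (continuous_apply i)).comp_continuousOn this
  obtain ⟨M₁, h₁⟩ := isCompact_Icc.exists_bound_of_continuousOn (hc C)
  obtain ⟨M₂, h₂⟩ := isCompact_Icc.exists_bound_of_continuousOn (hc (B - C))
  have hb : ∀ t ∈ Icc 0 T, ‖liouv B C (s t) (X t) i j‖ ≤ M₁ + M₂ := by
    intro t ht
    refine (norm_add_le _ _).trans (add_le_add (h₁ t ht) ?_)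
    have h0 := hs.2 t ht
    rw [Matrix.smul_apply, smul_eq_mul, norm_mul, Complex.norm_real, Real.norm_of_nonneg h0.1]
    exact (mul_le_of_le_one_left (norm_nonneg _) h0.2).trans (h₂ t ht)
  refine ⟨⟨_, hb⟩, ?_⟩
  refine IntegrableOn.of_bound (C := M₁ + M₂) (by simp) ?_ ?_
  · refine AEStronglyMeasurable.add ((hc C).aestronglyMeasurable measurableSet_Icc) ?_
    exact (Complex.measurable_ofReal.comp_aemeasurable hs.1).aestronglyMeasurable.mul
      ((hc (B - C)).aestronglyMeasurable measurableSet_Icc)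
  · exact (ae_restrict_iff' measurableSet_Icc).2 (.of_forall hb)

/-- A solution of the integrated equation has Lipschitz entries, and solves the differential
equation almost everywhere by the Lebesgue differentiation theorem. -/
theorem IsSolution.isACCurve {B C : Matrix (Fin n) (Fin n) ℂ} {T : ℝ} {s : ℝ → ℝ}
    {X : ℝ → Matrix (Fin n) (Fin n) ℂ} (hT : 0 ≤ T) (hs : IsControl T s)
    (hX : IsSolution B C T s X) : IsACCurve T X (fun t => liouv B C (s t) (X t)) := by
  have hint : ∀ i j, IntervalIntegrable (fun t => liouv B C (s t) (X t) i j) volume 0 T := by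
    intro i j
    rw [intervalIntegrable_iff_integrableOn_Icc_of_le hT]
    exact (liouv_entry_integrableOn hs hX.1 i j).2
  constructor
  · intro i j
    obtain ⟨M, hM⟩ := (liouv_entry_integrableOn (B := B) (C := C) hs hX.1 i j).1
    refine LipschitzOnWith.absolutelyContinuousOnInterval (K := M.toNNReal) ?_
    rw [uIcc_of_le hT]
    refine LipschitzOnWith.of_dist_le_mul fun t ht u hu => ?_
    have hi : ∀ t ∈ Icc 0 T, IntervalIntegrable (fun t => liouv B C (s t) (X t) i j) volume 0 t :=
      fun t ht => (hint i j).mono_set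
        (by rw [uIcc_of_le ht.1, uIcc_of_le hT]; exact Icc_subset_Icc_right ht.2)
    rw [dist_eq_norm, hX.2 t ht i j, hX.2 u hu i j, add_sub_add_left_eq_sub,
      intervalIntegral.integral_interval_sub_left (hi t ht) (hi u hu), Real.dist_eq]
    refine intervalIntegral.norm_integral_le_of_norm_le_const fun x hx => ?_
    refine (hM x ?_).trans (Real.le_coe_toNNReal M)
    exact (uIcc_subset_Icc hu ht) (uIoc_subset_uIcc hx)
  · have : ∀ᵐ t, ∀ i j, t ∈ uIcc 0 T → ∀ c ∈ uIcc 0 T,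
        HasDerivAt (fun x => ∫ τ in c..x, liouv B C (s τ) (X τ) i j)
          (liouv B C (s t) (X t) i j) t := by
      simp only [ae_all_iff]
      exact fun i j => (hint i j).ae_hasDerivAt_integral
    filter_upwards [this] with t ht hmem i j
    have h0 : (0 : ℝ) ∈ uIcc 0 T := left_mem_uIcc
    have := (ht i j (by rw [uIcc_of_le hT]; exact Ioo_subset_Icc_self hmem) 0 h0).const_add
      (X 0 i j)
    refine this.congr_of_eventuallyEq ?_
    filter_upwards [Icc_mem_nhds hmem.1 hmem.2] with u hu
    exact hX.2 u hu i j

/-- Along two solutions driven by different controls, the Hilbert–Schmidt product changes only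
through the difference of the controls: the common part of the generator is skew-adjoint. -/
theorem IsSolution.re_hs_sub {B C : Matrix (Fin n) (Fin n) ℂ} (hB : B.IsHermitian)
    (hC : C.IsHermitian) {T : ℝ} {s₁ s₂ : ℝ → ℝ} {P R : ℝ → Matrix (Fin n) (Fin n) ℂ} (hT : 0 ≤ T)
    (hs₁ : IsControl T s₁) (hs₂ : IsControl T s₂) (hP : IsSolution B C T s₁ P)
    (hR : IsSolution B C T s₂ R) {t : ℝ} (ht : t ∈ Icc 0 T) :
    (hs (P t) (R t)).re - (hs (P 0) (R 0)).re =
      ∫ τ in (0 : ℝ)..t, (s₂ τ - s₁ τ) * switching B C (P τ) (R τ) := by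
  have hP' := hP.isACCurve hT hs₁
  have hR' := hR.isACCurve hT hs₂
  rw [← (hP'.absCont_re_hs hR').integral_eq_sub_of_ae_hasDerivAt (hP'.hasDerivAt_re_hs hR') ht]
  congr 1
  funext τ
  rw [hs_liouv_left hB hC, liouv, liouv, hs_add_right, hs_add_right, hs_smul_right, hs_smul_right,
    switching]
  simp
  ring

/-! ### Existence of states and co-states -/

/-- The equation is solved in `Fin n → Fin n → ℂ`, which carries a norm; `Matrix` has none as a global
instance. -/
theorem exists_isSolution (B C : Matrix (Fin n) (Fin n) ℂ) {T : ℝ} (hT : 0 ≤ T) {s : ℝ → ℝ}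
    (hs : IsControl T s) (X₀ : Matrix (Fin n) (Fin n) ℂ) :
    ∃ X, IsSolution B C T s X ∧ X 0 = X₀ := by
  let e := Matrix.ofLinearEquiv ℝ (m := Fin n) (n := Fin n) (α := ℂ)
  let KL : Matrix (Fin n) (Fin n) ℂ → (Fin n → Fin n → ℂ) →L[ℝ] (Fin n → Fin n → ℂ) := fun D =>
    LinearMap.toContinuousLinearMap
      (e.symm.toLinearMap ∘ₗ (KLin D).restrictScalars ℝ ∘ₗ e.toLinearMap)
  obtain ⟨X, hX, hXi, h⟩ := exists_linear_caratheodory_solution hT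
    (L := fun t => KL C + s t • KL (B - C))
    (M := ‖KL C‖ + ‖KL (B - C)‖) (aestronglyMeasurable_const.add
      (hs.1.aestronglyMeasurable.smul aestronglyMeasurable_const)) (fun t ht => by
        refine (norm_add_le _ _).trans (add_le_add le_rfl ?_)
        rw [norm_smul, Real.norm_of_nonneg (hs.2 t ht).1]
        exact mul_le_of_le_one_left (norm_nonneg _) (hs.2 t ht).2) (e.symm X₀)
  have hL : ∀ t i j, (KL C + s t • KL (B - C)) (X t) i j = liouv B C (s t) (e (X t)) i j := by
    intro t i j
    change K C (e (X t)) i j + s t • K (B - C) (e (X t)) i j =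
      K C (e (X t)) i j + (s t : ℂ) • K (B - C) (e (X t)) i j
    rw [Complex.coe_smul]
  have h0 : X 0 = e.symm X₀ := by simpa using h 0 ⟨le_rfl, hT⟩
  refine ⟨fun t => e (X t), ⟨?_, fun t ht i j => ?_⟩, by simp [h0]⟩
  · exact (continuous_matrix fun i j =>
      (continuous_apply j).comp ((continuous_apply i).comp hX)).continuousOn
  · change X t i j = X 0 i j + _
    rw [h t ht, h0]
    simp only [← hL, Pi.add_apply]
    congr 1
    have hi : IntervalIntegrable (fun τ => (KL C + s τ • KL (B - C)) (X τ)) volume 0 t := by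
      rw [intervalIntegrable_iff_integrableOn_Icc_of_le ht.1]
      exact hXi.mono_set (Icc_subset_Icc_right ht.2)
    exact (((ContinuousLinearMap.proj (R := ℝ) (φ := fun _ : Fin n => ℂ) j).comp
      (ContinuousLinearMap.proj (R := ℝ) (φ := fun _ : Fin n => Fin n → ℂ) i)
      ).intervalIntegral_comp_comm hi).symm

/-- Reversing time turns the equation for `(B, C)` into the one for `(-B, -C)`. -/
theorem IsSolution.reverse {B C : Matrix (Fin n) (Fin n) ℂ} {T : ℝ} (hT : 0 ≤ T)
    {s : ℝ → ℝ} (hs : IsControl T s) {X : ℝ → Matrix (Fin n) (Fin n) ℂ}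
    (hX : IsSolution B C T s X) :
    IsSolution (-B) (-C) T (fun t => s (T - t)) (fun t => X (T - t)) := by
  have hmem : ∀ t ∈ Icc 0 T, T - t ∈ Icc 0 T := fun t ht => ⟨by linarith [ht.2], by linarith [ht.1]⟩
  have hneg : ∀ v Y i j, liouv (-B) (-C) v Y i j = -liouv B C v Y i j := by
    intro v Y i j
    have : ∀ D : Matrix (Fin n) (Fin n) ℂ, K (-D) Y = -K D Y := by
      intro D
      simp only [K, neg_mul, mul_neg, ← smul_neg]
      congr 1
      abel
    rw [liouv, liouv, this, show -B - -C = -(B - C) by abel, this, smul_neg, ← neg_add,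
      Matrix.neg_apply]
  refine ⟨hX.1.comp (by fun_prop) hmem, fun t ht i j => ?_⟩
  have hi : ∀ u ∈ Icc 0 T, IntervalIntegrable (fun t => liouv B C (s t) (X t) i j) volume 0 u := by
    intro u hu
    rw [intervalIntegrable_iff_integrableOn_Icc_of_le hu.1]
    exact (liouv_entry_integrableOn hs hX.1 i j).2.mono_set (Icc_subset_Icc_right hu.2)
  have h1 := hX.2 (T - t) (hmem t ht) i j
  have h2 := hX.2 T ⟨hT, le_rfl⟩ i j
  simp only [hneg, intervalIntegral.integral_neg, sub_zero]
  rw [intervalIntegral.integral_comp_sub_left (fun τ => liouv B C (s τ) (X τ) i j), sub_zero, h1, h2,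
    ← intervalIntegral.integral_interval_sub_left (hi T ⟨hT, le_rfl⟩) (hi _ (hmem t ht))]
  ring

theorem IsControl.reverse {T : ℝ} {s : ℝ → ℝ} (hs : IsControl T s) :
    IsControl T (fun t => s (T - t)) := by
  refine ⟨?_, fun t ht => hs.2 _ ⟨by linarith [ht.2], by linarith [ht.1]⟩⟩
  have h : MeasurePreserving (fun t : ℝ => T - t) (volume.restrict (Icc 0 T))
      (volume.restrict (Icc 0 T)) := by
    have := (Measure.measurePreserving_sub_left (volume : Measure ℝ) T).restrict_preimage
      (measurableSet_Icc (a := 0) (b := T))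
    simpa using this
  exact hs.1.comp_quasiMeasurePreserving h.quasiMeasurePreserving

theorem exists_isSolution_terminal (B C : Matrix (Fin n) (Fin n) ℂ) {T : ℝ} (hT : 0 ≤ T)
    {s : ℝ → ℝ} (hs : IsControl T s) (X₁ : Matrix (Fin n) (Fin n) ℂ) :
    ∃ X, IsSolution B C T s X ∧ X T = X₁ := by
  obtain ⟨Y, hY, hY0⟩ := exists_isSolution (-B) (-C) hT hs.reverse X₁
  refine ⟨fun t => Y (T - t), ?_, by simpa using hY0⟩
  simpa using hY.reverse hT hs.reverse

/-- Since `𝒦_B` and `𝒦_C` commute with the adjoint, so does the equation. -/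
theorem IsSolution.hermitian_part {B C : Matrix (Fin n) (Fin n) ℂ} (hB : B.IsHermitian)
    (hC : C.IsHermitian) {T : ℝ} {s : ℝ → ℝ} (hs : IsControl T s)
    {X : ℝ → Matrix (Fin n) (Fin n) ℂ} (hX : IsSolution B C T s X) :
    IsSolution B C T s (fun t => (1 / 2 : ℂ) • (X t + (X t)ᴴ)) := by
  have hl : ∀ v Y i j, liouv B C v ((1 / 2 : ℂ) • (Y + Yᴴ)) i j =
      (1 / 2 : ℂ) * (liouv B C v Y i j + star (liouv B C v Y j i)) := by
    intro v Y i j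
    rw [← Matrix.conjTranspose_apply]
    simp only [liouv, K_smul, K_add, Matrix.conjTranspose_add, Matrix.conjTranspose_smul,
      K_conjTranspose hC, K_conjTranspose (hB.sub hC), Matrix.add_apply, Matrix.smul_apply,
      smul_eq_mul]
    simp
    ring
  refine ⟨((continuous_id.add continuous_id.matrix_conjTranspose).const_smul
    (1 / 2 : ℂ)).comp_continuousOn hX.1, fun t ht i j => ?_⟩
  have hi : ∀ i j, IntervalIntegrable (fun t => liouv B C (s t) (X t) i j) volume 0 t := by
    intro i j
    rw [intervalIntegrable_iff_integrableOn_Icc_of_le ht.1]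
    exact (liouv_entry_integrableOn hs hX.1 i j).2.mono_set (Icc_subset_Icc_right ht.2)
  have hstar : ∫ τ in (0 : ℝ)..t, star (liouv B C (s τ) (X τ) j i) =
      star (∫ τ in (0 : ℝ)..t, liouv B C (s τ) (X τ) j i) :=
    (starL' ℝ (A := ℂ)).toContinuousLinearMap.intervalIntegral_comp_comm (hi j i)
  have hi' : IntervalIntegrable (fun t => star (liouv B C (s t) (X t) j i)) volume 0 t := by
    have := (hi j i)
    rw [intervalIntegrable_iff] at this ⊢
    exact (starL' ℝ (A := ℂ)).toContinuousLinearMap.integrable_comp this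
  simp only [hl]
  rw [intervalIntegral.integral_const_mul, intervalIntegral.integral_add (hi i j) hi', hstar]
  simp only [Matrix.smul_apply, Matrix.add_apply, Matrix.conjTranspose_apply, smul_eq_mul]
  rw [hX.2 t ht i j, hX.2 t ht j i, star_add]
  ring

/-! ### The maximum principle -/

theorem switching_eq_neg {B C : Matrix (Fin n) (Fin n) ℂ} (hB : B.IsHermitian)
    (hC : C.IsHermitian) (P R : Matrix (Fin n) (Fin n) ℂ) :
    switching B C P R = -(hs (K (B - C) P) R).re := by
  rw [hs_K_left (hB.sub hC)]; simp [switching]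

theorem continuousOn_switching {B C : Matrix (Fin n) (Fin n) ℂ}
    {P R : ℝ → Matrix (Fin n) (Fin n) ℂ} {S : Set ℝ} (hP : ContinuousOn P S)
    (hR : ContinuousOn R S) : ContinuousOn (fun t => switching B C (P t) (R t)) S :=
  Complex.continuous_re.comp_continuousOn (continuousOn_hs hP (continuousOn_K _ hR))

theorem IsControl.intervalIntegrable_sub_mul {T : ℝ} (hT : 0 ≤ T) {s v : ℝ → ℝ}
    (hs : IsControl T s) (hv : IsControl T v) {g : ℝ → ℝ} (hg : ContinuousOn g (Icc 0 T)) :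
    IntervalIntegrable (fun t => (v t - s t) * g t) volume 0 T := by
  rw [intervalIntegrable_iff_integrableOn_Icc_of_le hT]
  obtain ⟨M, hM⟩ := isCompact_Icc.exists_bound_of_continuousOn hg
  refine IntegrableOn.of_bound (C := M) (by simp) ((hv.1.sub hs.1).aestronglyMeasurable.mul
    (hg.aestronglyMeasurable measurableSet_Icc))
    ((ae_restrict_iff' measurableSet_Icc).2 (.of_forall fun t ht => ?_))
  rw [norm_mul, Real.norm_eq_abs]
  have h1 := hs.2 t ht
  have h2 := hv.2 t ht
  exact (mul_le_of_le_one_left (norm_nonneg _)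
    (abs_le.2 ⟨by linarith [h1.2, h2.1], by linarith [h1.1, h2.2]⟩)).trans (hM t ht)

theorem IsControl.interpolate {T : ℝ} {s v : ℝ → ℝ} (hs : IsControl T s) (hv : IsControl T v)
    {ε : ℝ} (h0 : 0 ≤ ε) (h1 : ε ≤ 1) : IsControl T (fun t => s t + ε * (v t - s t)) := by
  refine ⟨hs.1.add ((hv.1.sub hs.1).const_mul ε), fun t ht => ?_⟩
  have a := hs.2 t ht
  have b := hv.2 t ht
  constructor <;> nlinarith [a.1, a.2, b.1, b.2]

/-- The squared Hilbert–Schmidt norm is conserved. -/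
theorem IsSolution.hs_self_re {B C : Matrix (Fin n) (Fin n) ℂ} (hB : B.IsHermitian)
    (hC : C.IsHermitian) {T : ℝ} (hT : 0 ≤ T) {s : ℝ → ℝ} (hs : IsControl T s)
    {X : ℝ → Matrix (Fin n) (Fin n) ℂ} (hX : IsSolution B C T s X) {t : ℝ} (ht : t ∈ Icc 0 T) :
    (QControl.hs (X t) (X t)).re = (QControl.hs (X 0) (X 0)).re := by
  have := hX.re_hs_sub hB hC hT hs hs hX ht
  simp only [sub_self, zero_mul, intervalIntegral.integral_zero] at this
  linarith

/-- Moving the control by `ε (v - s)` moves the state by `O(√ε)` in the Hilbert–Schmidt norm. As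
both states keep the norm of the initial one, `‖R - ρ‖² = 2 ‖ρ 0‖² - 2 Re ⟨ρ, R⟩`, and the last term is
controlled by `IsSolution.re_hs_sub`; no Gronwall estimate is needed. -/
theorem IsSolution.exists_perturbation_bound {B C : Matrix (Fin n) (Fin n) ℂ} (hB : B.IsHermitian)
    (hC : C.IsHermitian) {T : ℝ} (hT : 0 ≤ T) {s v : ℝ → ℝ} (hs : IsControl T s)
    (hv : IsControl T v) {ρ : ℝ → Matrix (Fin n) (Fin n) ℂ} (hρ : IsSolution B C T s ρ) :
    ∃ c : ℝ, ∀ ε ∈ Ioc (0 : ℝ) 1, ∀ R, IsSolution B C T (fun t => s t + ε * (v t - s t)) R →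
      R 0 = ρ 0 → ∀ t ∈ Icc 0 T, (QControl.hs (R t - ρ t) (R t - ρ t)).re ≤ c * ε := by
  obtain ⟨a, ha⟩ := isCompact_Icc.exists_bound_of_continuousOn (s := Icc (0 : ℝ) T)
    (f := fun t => QControl.hs (K (B - C) (ρ t)) (K (B - C) (ρ t)))
    (continuousOn_hs (continuousOn_K _ hρ.1) (continuousOn_K _ hρ.1))
  set N := (QControl.hs (ρ 0) (ρ 0)).re with hN
  have ha0 : 0 ≤ a := (norm_nonneg _).trans (ha 0 ⟨le_rfl, hT⟩)
  have hN0 : 0 ≤ N := hs_self_re_nonneg _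
  refine ⟨(a + N) * T, fun ε hε R hR hR0 t ht => ?_⟩
  have hsε := hs.interpolate hv hε.1.le hε.2
  have hRN : ∀ τ ∈ Icc 0 T, (QControl.hs (R τ) (R τ)).re = N := fun τ hτ => by
    rw [hR.hs_self_re hB hC hT hsε hτ, hR0]
  have h1 := hρ.re_hs_sub hB hC hT hs hsε hR ht
  rw [hR0, ← hN] at h1
  have h2 : ‖∫ τ in (0 : ℝ)..t, (s τ + ε * (v τ - s τ) - s τ) * switching B C (ρ τ) (R τ)‖ ≤
      ε * ((a + N) / 2) * |t - 0| := by
    refine intervalIntegral.norm_integral_le_of_norm_le_const fun τ hτ => ?_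
    rw [uIoc_of_le ht.1] at hτ
    have hτ' : τ ∈ Icc 0 T := ⟨hτ.1.le, hτ.2.trans ht.2⟩
    have hsw : |switching B C (ρ τ) (R τ)| ≤ (a + N) / 2 := by
      rw [switching_eq_neg hB hC, abs_neg]
      refine (abs_re_hs_le one_pos _ _).trans ?_
      rw [hRN τ hτ', one_mul, div_one]
      gcongr
      exact (Complex.re_le_norm _).trans (ha τ hτ')
    have x := hs.2 τ hτ'
    have y := hv.2 τ hτ'
    rw [add_sub_cancel_left, norm_mul, norm_mul, Real.norm_of_nonneg hε.1.le, mul_assoc]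
    refine mul_le_mul_of_nonneg_left ?_ hε.1.le
    exact (mul_le_of_le_one_left (norm_nonneg _)
      (abs_le.2 ⟨by linarith [x.2, y.1], by linarith [x.1, y.2]⟩)).trans hsw
  rw [← h1, sub_zero, abs_of_nonneg ht.1, Real.norm_eq_abs] at h2
  have h3 : ε * ((a + N) / 2) * t ≤ ε * ((a + N) / 2) * T :=
    mul_le_mul_of_nonneg_left ht.2 (mul_nonneg hε.1.le (by linarith))
  have h4 := neg_abs_le ((QControl.hs (ρ t) (R t)).re - N)
  rw [hs_sub_left, hs_sub_right, hs_sub_right]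
  simp only [Complex.sub_re]
  rw [hRN t ht, hρ.hs_self_re hB hC hT hs ht, hs_re_comm (R t) (ρ t)]
  linarith

/-- The integrated maximum principle: no admissible control has a larger integrated product with
the switching function than the optimal one. By `IsSolution.re_hs_sub` the gain of the convex
perturbation `s + ε (v - s)` is exactly `ε ∫ (v - s) ⟨p, 𝒦_{B-C} R⟩` along its own state `R`, and
`R → ρ` as `ε → 0`. -/
theorem IsOptimalPair.integral_le_zero {B C ρ₀ : Matrix (Fin n) (Fin n) ℂ} (hB : B.IsHermitian)
    (hC : C.IsHermitian) {T : ℝ} (hT : 0 ≤ T) {ρ p : ℝ → Matrix (Fin n) (Fin n) ℂ} {s v : ℝ → ℝ}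
    (hopt : IsOptimalPair B C ρ₀ T ρ s) (hp : IsSolution B C T s p) (hpT : p T = -C)
    (hv : IsControl T v) :
    ∫ t in (0 : ℝ)..T, (v t - s t) * switching B C (p t) (ρ t) ≤ 0 := by
  obtain ⟨⟨hs, hρ, hρ0⟩, hmin⟩ := hopt
  obtain ⟨c, hc⟩ := hρ.exists_perturbation_bound hB hC hT hs hv
  obtain ⟨a, ha⟩ := isCompact_Icc.exists_bound_of_continuousOn (s := Icc (0 : ℝ) T)
    (f := fun t => QControl.hs (K (B - C) (p t)) (K (B - C) (p t)))
    (continuousOn_hs (continuousOn_K _ hp.1) (continuousOn_K _ hp.1))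
  have hTT : T ∈ Icc 0 T := ⟨hT, le_rfl⟩
  have hcost : ∀ Y, (QControl.hs (p T) Y).re = -cost C Y := by
    intro Y
    rw [hpT, hs_neg_left, QControl.hs, hC.eq, cost, Complex.neg_re]
  -- the perturbation has size `η ^ 2`, so that the state moves by `O(η)`
  have key : ∀ η ∈ Ioc (0 : ℝ) 1,
      ∫ t in (0 : ℝ)..T, (v t - s t) * switching B C (p t) (ρ t) ≤ η * ((a + c) / 2 * T) := by
    intro η hη
    have hε : η ^ 2 ∈ Ioc (0 : ℝ) 1 := ⟨by have := hη.1; positivity, by nlinarith [hη.1, hη.2]⟩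
    have hsε := hs.interpolate hv hε.1.le hε.2
    obtain ⟨R, hR, hR0⟩ := exists_isSolution B C hT hsε ρ₀
    have h1 := hp.re_hs_sub hB hC hT hs hs hρ hTT
    have h2 := hp.re_hs_sub hB hC hT hs hsε hR hTT
    simp only [sub_self, zero_mul, intervalIntegral.integral_zero, add_sub_cancel_left,
      mul_assoc, intervalIntegral.integral_const_mul] at h1 h2
    rw [hcost, hρ0] at h1
    rw [hcost, hR0] at h2
    have h3 := hmin _ _ hsε hR hR0
    have h4 : ∫ t in (0 : ℝ)..T, (v t - s t) * switching B C (p t) (R t) ≤ 0 := by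
      by_contra! hpos
      have := mul_pos hε.1 hpos
      linarith
    have h5 : ‖∫ t in (0 : ℝ)..T, (v t - s t) * (switching B C (p t) (ρ t) -
        switching B C (p t) (R t))‖ ≤ η * ((a + c) / 2) * |T - 0| := by
      refine intervalIntegral.norm_integral_le_of_norm_le_const fun t ht => ?_
      rw [uIoc_of_le hT] at ht
      have ht' : t ∈ Icc 0 T := ⟨ht.1.le, ht.2⟩
      have x := hs.2 t ht'
      have y := hv.2 t ht'
      rw [norm_mul]
      refine (mul_le_of_le_one_left (norm_nonneg _)
        (abs_le.2 ⟨by linarith [x.2, y.1], by linarith [x.1, y.2]⟩)).trans ?_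
      rw [switching_eq_neg hB hC, switching_eq_neg hB hC, neg_sub_neg, ← Complex.sub_re,
        ← hs_sub_right, Real.norm_eq_abs]
      refine (abs_re_hs_le hη.1 _ _).trans ?_
      have e1 : (QControl.hs (K (B - C) (p t)) (K (B - C) (p t))).re ≤ a :=
        (Complex.re_le_norm _).trans (ha t ht')
      have e2 : (QControl.hs (R t - ρ t) (R t - ρ t)).re / η ≤ c * η := by
        rw [div_le_iff₀ hη.1, mul_assoc, ← sq]
        exact hc _ hε R hR (hR0.trans hρ0.symm) t ht'
      have e3 := mul_le_mul_of_nonneg_left e1 hη.1.le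
      linarith
    simp only [mul_sub (v _ - s _)] at h5
    rw [intervalIntegral.integral_sub
      (hs.intervalIntegrable_sub_mul hT hv (continuousOn_switching hp.1 hρ.1))
      (hs.intervalIntegrable_sub_mul hT hv (continuousOn_switching hp.1 hR.1)), sub_zero,
      abs_of_nonneg hT] at h5
    have := (le_abs_self _).trans h5
    linarith
  have hlim : Filter.Tendsto (fun η : ℝ => η * ((a + c) / 2 * T)) (nhdsWithin 0 (Ioi 0))
      (nhds 0) := by
    have : Continuous fun η : ℝ => η * ((a + c) / 2 * T) := by fun_prop
    simpa using (this.tendsto 0).mono_left nhdsWithin_le_nhds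
  refine ge_of_tendsto hlim ?_
  filter_upwards [Ioc_mem_nhdsGT (zero_lt_one' ℝ)] with η hη using key η hη

/-- The pointwise maximum principle: compare with the control `v` that is `1` where the switching
function is positive and `0` elsewhere, for which the integrand is nonnegative. -/
theorem IsOptimalPair.ae_maximizes {B C ρ₀ : Matrix (Fin n) (Fin n) ℂ} (hB : B.IsHermitian)
    (hC : C.IsHermitian) {T : ℝ} (hT : 0 ≤ T) {ρ p : ℝ → Matrix (Fin n) (Fin n) ℂ} {s : ℝ → ℝ}
    (hopt : IsOptimalPair B C ρ₀ T ρ s) (hp : IsSolution B C T s p) (hpT : p T = -C) :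
    ∀ᵐ t, t ∈ Icc 0 T → (switching B C (p t) (ρ t) < 0 → s t = 0) ∧
      (0 < switching B C (p t) (ρ t) → s t = 1) := by
  have hΦ := continuousOn_switching (B := B) (C := C) hp.1 hopt.1.2.1.1
  have hs := hopt.1.1
  set Φ := fun t => switching B C (p t) (ρ t) with hΦdef
  let v : ℝ → ℝ := fun t => (Ioi (0 : ℝ)).indicator 1 (Φ t)
  have hv : IsControl T v := by
    refine ⟨(measurable_one.indicator measurableSet_Ioi).comp_aemeasurable
      (hΦ.aemeasurable measurableSet_Icc), fun t _ => ?_⟩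
    by_cases h : 0 < Φ t <;> simp [v, h]
  have hle := hopt.integral_le_zero hB hC hT hp hpT hv
  have hnn : ∀ t ∈ Icc 0 T, 0 ≤ (v t - s t) * Φ t := by
    intro t ht
    have := hs.2 t ht
    by_cases h : 0 < Φ t
    · simp only [v, indicator, mem_Ioi, h, if_true, Pi.one_apply]
      exact mul_nonneg (by linarith [this.2]) h.le
    · simp only [v, indicator, mem_Ioi, h, if_false]
      exact mul_nonneg_of_nonpos_of_nonpos (by linarith [this.1]) (not_lt.1 h)
  have hi := hs.intervalIntegrable_sub_mul hT hv hΦ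
  rw [intervalIntegrable_iff_integrableOn_Icc_of_le hT] at hi
  have hnn' : 0 ≤ᵐ[volume.restrict (Icc 0 T)] fun t => (v t - s t) * Φ t :=
    (ae_restrict_iff' measurableSet_Icc).2 (.of_forall hnn)
  rw [intervalIntegral.integral_of_le hT, ← integral_Icc_eq_integral_Ioc] at hle
  have h0 := (setIntegral_eq_zero_iff_of_nonneg_ae hnn' hi).1
    (le_antisymm hle (integral_nonneg_of_ae hnn'))
  filter_upwards [(ae_restrict_iff' measurableSet_Icc).1 h0] with t ht hmem
  have := ht hmem
  constructor
  · intro hneg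
    have h : ¬ 0 < Φ t := not_lt.2 hneg.le
    simp only [v, indicator, mem_Ioi, h, if_false, Pi.zero_apply, zero_sub, neg_mul,
      neg_eq_zero, mul_eq_zero] at this
    exact this.resolve_right hneg.ne
  · intro hpos
    have h : 0 < Φ t := hpos
    simp only [v, indicator, mem_Ioi, h, if_true, Pi.zero_apply, Pi.one_apply, mul_eq_zero] at this
    linarith [this.resolve_right h.ne']

/-! ### Constancy of the control Hamiltonian -/

theorem pmpH_eq (B C P R : Matrix (Fin n) (Fin n) ℂ) (v : ℝ) :
    pmpH B C P R v = (hs P (K C R)).re + v * switching B C P R := by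
  rw [pmpH, liouv, hs_add_right, hs_smul_right, Complex.add_re, Complex.re_ofReal_mul, switching]

/-- The derivative of `⟨p, 𝒦_{B-C} ρ⟩` along a common control; the control value drops out. -/
def switchingDeriv (B C P R : Matrix (Fin n) (Fin n) ℂ) : ℝ :=
  (hs P (K (B - C) (K C R) - K C (K (B - C) R))).re

/-- The derivatives of `⟨p, 𝒦_{B-C} ρ⟩` and of `⟨p, 𝒦_C ρ⟩` along a common control `v`. -/
theorem re_hs_liouv_add {B C : Matrix (Fin n) (Fin n) ℂ} (hB : B.IsHermitian)
    (hC : C.IsHermitian) (v : ℝ) (P R : Matrix (Fin n) (Fin n) ℂ) :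
    (hs (liouv B C v P) (K (B - C) R)).re + (hs P (K (B - C) (liouv B C v R))).re =
        switchingDeriv B C P R ∧
      (hs (liouv B C v P) (K C R)).re + (hs P (K C (liouv B C v R))).re =
        -v * switchingDeriv B C P R := by
  rw [hs_liouv_left hB hC, hs_liouv_left hB hC]
  simp only [switchingDeriv, liouv, K_add, K_smul, hs_add_right,
    hs_smul_right, hs_sub_right, Complex.add_re, Complex.neg_re, Complex.re_ofReal_mul,
    Complex.sub_re]
  constructor <;> ring

/-- The maximized Hamiltonian is constant along an extremal. It is absolutely continuous, and its
derivative vanishes almost everywhere; the delicate points are the zeros of the switching function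
`Φ`. -/
theorem maximizedHamiltonian_const {B C : Matrix (Fin n) (Fin n) ℂ} (hB : B.IsHermitian)
    (hC : C.IsHermitian) {T : ℝ} (hT : 0 ≤ T) {ρ p : ℝ → Matrix (Fin n) (Fin n) ℂ} {s : ℝ → ℝ}
    (hs : IsControl T s) (hρ : IsSolution B C T s ρ) (hp : IsSolution B C T s p)
    (hmax : ∀ᵐ t, t ∈ Icc 0 T → (switching B C (p t) (ρ t) < 0 → s t = 0) ∧
      (0 < switching B C (p t) (ρ t) → s t = 1)) :
    ∃ c, ∀ t ∈ Icc 0 T,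
      (QControl.hs (p t) (K C (ρ t))).re + max (switching B C (p t) (ρ t)) 0 = c := by
  have hρ' := hρ.isACCurve hT hs
  have hp' := hp.isACCurve hT hs
  have hG := hp'.absCont_re_hs (hρ'.K_comp C)
  have hΦ : AbsolutelyContinuousOnInterval (fun t => switching B C (p t) (ρ t)) 0 T :=
    hp'.absCont_re_hs (hρ'.K_comp (B - C))
  have hΦd : ∀ᵐ t, t ∈ Ioo 0 T → HasDerivAt (fun t => switching B C (p t) (ρ t))
      (switchingDeriv B C (p t) (ρ t)) t := by
    filter_upwards [hp'.hasDerivAt_re_hs (hρ'.K_comp (B - C))] with t ht hmem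
    exact (re_hs_liouv_add hB hC (s t) (p t) (ρ t)).1 ▸ ht hmem
  have hGd : ∀ᵐ t, t ∈ Ioo 0 T → HasDerivAt (fun t => (QControl.hs (p t) (K C (ρ t))).re)
      (-s t * switchingDeriv B C (p t) (ρ t)) t := by
    filter_upwards [hp'.hasDerivAt_re_hs (hρ'.K_comp C)] with t ht hmem
    exact (re_hs_liouv_add hB hC (s t) (p t) (ρ t)).2 ▸ ht hmem
  have hM := hΦ.max_zero
  obtain ⟨c, hc⟩ := (hG.fun_add hM).const_of_ae_hasDerivAt_zero (by
    have hne : ∀ᵐ x : ℝ, x ≠ T ∧ x ≠ 0 :=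
      (ae_iff.2 (by simp) : ∀ᵐ x : ℝ, x ≠ T).and (ae_iff.2 (by simp))
    filter_upwards [hmax, hΦd, hGd, hM.ae_differentiableAt, hne] with t h1 h2 h3 h4 h5 hmem
    have hmem' := hmem
    rw [uIcc_of_le hT] at hmem'
    have hIoo : t ∈ Ioo 0 T := ⟨lt_of_le_of_ne hmem'.1 h5.2.symm, lt_of_le_of_ne hmem'.2 h5.1⟩
    replace h1 := h1 hmem'
    replace h2 := h2 hIoo
    replace h3 := h3 hIoo
    replace h4 := (h4 hmem).hasDerivAt
    generalize switchingDeriv B C (p t) (ρ t) = D at h2 h3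
    rcases lt_trichotomy (switching B C (p t) (ρ t)) 0 with h | h | h
    · have e : (fun t => max (switching B C (p t) (ρ t)) 0) =ᶠ[nhds t] fun _ => 0 := by
        filter_upwards [h2.continuousAt.eventually_lt_const h] with u hu using max_eq_right hu.le
      have := h3.fun_add ((hasDerivAt_const t (0 : ℝ)).congr_of_eventuallyEq e)
      rw [h1.1 h] at this
      simpa using this
    · -- at a zero of `Φ`, `max Φ 0` is minimal and `Φ - max Φ 0 = min Φ 0` is maximal; where both are
      -- differentiable, their derivatives vanish, hence so does `Φ' = D`
      have hmin : IsLocalMin (fun t => max (switching B C (p t) (ρ t)) 0) t :=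
        .of_forall fun u => by simp [h]
      have hmax' : IsLocalMax (fun t => switching B C (p t) (ρ t) -
          max (switching B C (p t) (ρ t)) 0) t :=
        .of_forall fun u => by simp [h]
      have e1 := hmin.hasDerivAt_eq_zero h4
      have e2 := hmax'.hasDerivAt_eq_zero (h2.sub h4)
      have := h3.fun_add h4
      rw [e1, sub_zero] at e2
      rw [e1, e2] at this
      simpa using this
    · have e : (fun t => max (switching B C (p t) (ρ t)) 0) =ᶠ[nhds t]
          fun t => switching B C (p t) (ρ t) := by
        filter_upwards [h2.continuousAt.eventually_const_lt h] with u hu using max_eq_left hu.le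
      have := h3.fun_add (h2.congr_of_eventuallyEq e)
      rw [h1.2 h] at this
      simpa using this)
  exact ⟨c, fun t ht => hc t (by rwa [uIcc_of_le hT])⟩

theorem IsSolution.congr_control {B C : Matrix (Fin n) (Fin n) ℂ} {T : ℝ} {s s' : ℝ → ℝ}
    {X : ℝ → Matrix (Fin n) (Fin n) ℂ} (hX : IsSolution B C T s X)
    (h : s' =ᵐ[volume.restrict (Icc 0 T)] s) : IsSolution B C T s' X := by
  refine ⟨hX.1, fun t ht i j => (hX.2 t ht i j).trans ?_⟩
  congr 1
  refine intervalIntegral.integral_congr_ae ?_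
  filter_upwards [(ae_restrict_iff' measurableSet_Icc).1 h] with τ hτ hmem
  rw [uIoc_of_le ht.1] at hmem
  rw [hτ ⟨hmem.1.le, hmem.2.trans ht.2⟩]

/-- The co-state with a prescribed terminal value. It vanishes nowhere as its Hilbert–Schmidt norm is
conserved. -/
theorem exists_hermitian_costate {B C : Matrix (Fin n) (Fin n) ℂ} (hB : B.IsHermitian)
    (hC : C.IsHermitian) {T : ℝ} (hT : 0 ≤ T) {s : ℝ → ℝ} (hs : IsControl T s)
    {P₁ : Matrix (Fin n) (Fin n) ℂ} (hP : P₁.IsHermitian) (hP0 : P₁ ≠ 0) :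
    ∃ p, IsSolution B C T s p ∧ p T = P₁ ∧ ∀ t ∈ Icc 0 T, (p t).IsHermitian ∧ p t ≠ 0 := by
  obtain ⟨X, hX, hXT⟩ := exists_isSolution_terminal B C hT hs P₁
  have hp := hX.hermitian_part hB hC hs
  have hpT : (1 / 2 : ℂ) • (X T + (X T)ᴴ) = P₁ := by
    rw [hXT, hP.eq, ← two_smul ℂ P₁, smul_smul]; norm_num
  refine ⟨_, hp, hpT, fun t ht => ⟨?_, fun h0 => hP0 ?_⟩⟩
  · rw [Matrix.IsHermitian, Matrix.conjTranspose_smul, Matrix.conjTranspose_add,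
      Matrix.conjTranspose_conjTranspose, add_comm]
    simp
  · have e1 := hp.hs_self_re hB hC hT hs ht
    have e2 := hp.hs_self_re hB hC hT hs ⟨hT, le_refl T⟩
    rw [hpT, ← e1, h0] at e2
    exact eq_zero_of_hs_self_re (by simpa [QControl.hs] using e2)

end QControl

theorem theorem2 (n : ℕ) (B C ρ₀ : Matrix (Fin n) (Fin n) ℂ) (T : ℝ)
    (hB : B.IsHermitian) (hC : C.IsHermitian) (hC0 : C ≠ 0) (hρ₀ : IsDensity ρ₀) (hT : 0 < T)
    (ρ : ℝ → Matrix (Fin n) (Fin n) ℂ) (s : ℝ → ℝ) (hopt : IsOptimalPair B C ρ₀ T ρ s) :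
    ∃ (p : ℝ → Matrix (Fin n) (Fin n) ℂ) (lam : ℝ) (s' : ℝ → ℝ),
      -- the optimal control, normalized on a null set
      s' =ᵐ[MeasureTheory.volume.restrict (Set.Icc 0 T)] s ∧ IsOptimalPair B C ρ₀ T ρ s' ∧
      -- the co-state
      IsSolution B C T s p ∧ p T = -C ∧
      (∀ t ∈ Set.Icc 0 T, (p t).IsHermitian ∧ p t ≠ 0) ∧
      -- nonsingular arcs
      (∀ t ∈ Set.Icc 0 T, switching B C (p t) (ρ t) < 0 → s' t = 0) ∧
      (∀ t ∈ Set.Icc 0 T, 0 < switching B C (p t) (ρ t) → s' t = 1) ∧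
      -- all other intervals are singular arcs
      (∀ a b : ℝ, 0 ≤ a → a < b → b ≤ T →
        (¬ ∃ c d : ℝ, a ≤ c ∧ c < d ∧ d ≤ b ∧
          ((∀ t ∈ Set.Ioo c d, switching B C (p t) (ρ t) < 0) ∨
            (∀ t ∈ Set.Ioo c d, 0 < switching B C (p t) (ρ t)))) →
        ∀ t ∈ Set.Icc a b, switching B C (p t) (ρ t) = 0 ∧
          ∀ v w : ℝ, pmpH B C (p t) (ρ t) v = pmpH B C (p t) (ρ t) w) ∧
      -- the constant value of the control Hamiltonian
      (∀ t ∈ Set.Icc 0 T, pmpH B C (p t) (ρ t) (s' t) = lam) ∧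
      -- the final and the initial arc when the constraint on the final time is active
      (0 < lam →
        (∃ ε : ℝ, 0 < ε ∧ ε ≤ T ∧ ∀ t ∈ Set.Ioc (T - ε) T, s' t = 1) ∧
        (K B ρ₀ = 0 → ∃ ε' : ℝ, 0 < ε' ∧ ε' ≤ T ∧ ∀ t ∈ Set.Ico 0 ε', s' t = 0)) := by

  classical
  have hs := hopt.1.1
  have hρ := hopt.1.2.1
  obtain ⟨p, hp, hpT, hpH⟩ := exists_hermitian_costate hB hC hT.le hs hC.neg (neg_ne_zero.2 hC0)
  have hΦ := continuousOn_switching (B := B) (C := C) hp.1 hρ.1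
  have hmax := hopt.ae_maximizes hB hC hT.le hp hpT
  obtain ⟨lam, hlam⟩ := maximizedHamiltonian_const hB hC hT.le hs hρ hp hmax
  let s' : ℝ → ℝ := fun t => if switching B C (p t) (ρ t) < 0 then 0 else
    if 0 < switching B C (p t) (ρ t) then 1 else s t
  have hs'neg : ∀ t, switching B C (p t) (ρ t) < 0 → s' t = 0 := fun t h => by simp [s', h]
  have hs'pos : ∀ t, 0 < switching B C (p t) (ρ t) → s' t = 1 := fun t h => by
    simp [s', h, not_lt.2 h.le]
  have hs's : s' =ᵐ[volume.restrict (Icc 0 T)] s := by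
    refine (ae_restrict_iff' measurableSet_Icc).2 ?_
    filter_upwards [hmax] with t ht hmem
    rcases lt_trichotomy (switching B C (p t) (ρ t)) 0 with h | h | h
    · rw [hs'neg t h, (ht hmem).1 h]
    · simp [s', h]
    · rw [hs'pos t h, (ht hmem).2 h]
  have hs'c : IsControl T s' := by
    refine ⟨hs.1.congr hs's.symm, fun t ht => ?_⟩
    simp only [s']
    split_ifs
    exacts [⟨le_rfl, zero_le_one⟩, ⟨zero_le_one, le_rfl⟩, hs.2 t ht]
  have hH : ∀ t ∈ Icc 0 T, pmpH B C (p t) (ρ t) (s' t) = lam := by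
    intro t ht
    rw [pmpH_eq, ← hlam t ht]
    congr 1
    rcases lt_trichotomy (switching B C (p t) (ρ t)) 0 with h | h | h
    · rw [hs'neg t h, max_eq_right h.le, zero_mul]
    · simp [h]
    · rw [hs'pos t h, max_eq_left h.le, one_mul]
  refine ⟨p, lam, s', hs's, ⟨⟨hs'c, hρ.congr_control hs's, hopt.1.2.2⟩, hopt.2⟩, hp, hpT, hpH,
    fun t _ => hs'neg t, fun t _ => hs'pos t, ?_, hH, fun hpos => ⟨?_, fun hBρ => ?_⟩⟩
  · intro a b ha hab hb hno t ht
    have h0 := eq_zero_of_no_sign_interval hab (hΦ.mono (Icc_subset_Icc ha hb)) hno t ht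
    exact ⟨h0, fun v w => by rw [pmpH_eq, pmpH_eq, h0, mul_zero, mul_zero]⟩
  · -- at the final time `⟨p, 𝒦_C ρ⟩ = -⟨C, 𝒦_C ρ⟩ = 0`, so `lam = max Φ 0`
    have hend := hlam T ⟨hT.le, le_rfl⟩
    rw [show (QControl.hs (p T) (K C (ρ T))).re = 0 by
      rw [hpT, hs_neg_left, hs_K_self hC]; simp, zero_add] at hend
    have hΦT : 0 < switching B C (p T) (ρ T) := by
      by_contra! hle
      rw [max_eq_right hle] at hend
      exact hpos.ne hend
    obtain ⟨ε, h1, h2, h3⟩ := exists_Ioc_pos_of_continuousOn hT hΦ hΦT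
    exact ⟨ε, h1, h2, fun t ht => hs'pos t (h3 t ht)⟩
  · -- at the initial time `𝒦_C ρ₀ = -𝒦_{B-C} ρ₀`, so `lam = max Φ 0 - Φ`
    have hini := hlam 0 ⟨le_rfl, hT.le⟩
    have hsw : (QControl.hs (p 0) (K C (ρ 0))).re = -switching B C (p 0) (ρ 0) := by
      rw [switching, hopt.1.2.2, K_sub_eq_neg hBρ]
      simp [QControl.hs]
    have hΦ0 : switching B C (p 0) (ρ 0) < 0 := by
      by_contra! hge
      rw [hsw, max_eq_left hge, neg_add_cancel] at hini
      exact hpos.ne hini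
    obtain ⟨ε, h1, h2, h3⟩ := exists_Ico_neg_of_continuousOn hT hΦ hΦ0
    exact ⟨ε, h1, h2, fun t ht => hs'neg t (h3 t ht)⟩
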